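/- Let $K$ be a field and let $S=K[x_1,\ldots,x_n]$ be standard graded. A linear complex with initial degree $d\in\mathbb Z$ is a complex $\cdots\to G_2\to G_1\to G_0\to 0$ of graded $S$-modules with homogeneous differentials of degree $0$ such that, for every $i\ge 0$, $G_i\cong S(-i-d)^{b_i}$ for some integer $b_i\ge 0$; it is finite if $G_i=0$ for all large $i$. Let $W$ be a finitely generated graded $S$-module with initial degree $e$, that is, $e$ is the least integer with $W_e\neq 0$ (if $W=0$, any integer $e$ is allowed). Let $F$ be the minimal graded free resolution of $W$, with $F_i=\bigoplus_j S(-j)^{\beta_{i,j}}$, and let $F_i^{\mathrm{lin}}$ be the direct summand $S(-i-e)^{\beta_{i,i+e}}$ of $F_i$. The differential of $F$ maps $F_{i+1}^{\mathrm{lin}}$ into $F_{i}^{\mathrm{lin}}$ for all $i\ge 0$, and the resulting subcomplex $F^{\mathrm{lin}}:\ \cdots\to F_1^{\mathrm{lin}}\to F_0^{\mathrm{lin}}\to 0$ of $F$ is called the linear strand of $W$. **Corollary.** Let $G$ be a finite linear complex with initial degree $d$ such that $H_i(G)_{i+d+j}=0$ for all $i>0$ and for $j=0,1$. Let $W$ be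 a finitely generated graded $S$-module with minimal graded free resolution $F$ such that the graded map $G_1\to G_0$ is isomorphic to $F_1^{\mathrm{lin}}\to F_0^{\mathrm{lin}}$. Then $G$ is isomorphic, as a complex of graded $S$-modules, to the linear strand $F^{\mathrm{lin}}$ of $W$. -/

import Mathlib

namespace LinStrand

universe u v w w'

/-- A `ℤ`-grading, by additive subgroups `𝒲 j` (`j : ℤ`), of a module `W` over the standard graded
polynomial ring `S = K[x₁, …, xₙ]`: `W` is the internal direct sum of the `𝒲 j`, and
`S_a • 𝒲 j ⊆ 𝒲 (a + j)`. -/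
structure IsGrading {K : Type u} [Field K] {n : ℕ} {W : Type v} [AddCommGroup W]
    [Module (MvPolynomial (Fin n) K) W] (𝒲 : ℤ → AddSubgroup W) : Prop where
  isInternal : DirectSum.IsInternal 𝒲
  smul_mem : ∀ (a : ℕ) (j : ℤ) (f : MvPolynomial (Fin n) K) (x : W),
    f.IsHomogeneous a → x ∈ 𝒲 j → f • x ∈ 𝒲 ((a : ℤ) + j)

/-- `e` is the initial degree of the graded module: the least `j` with `𝒲 j ≠ 0`.
For the zero module, which has no nonzero component, every integer is allowed. -/
structure IsInitialDegree {W : Type v} [AddCommGroup W] (𝒲 : ℤ → AddSubgroup W) (e : ℤ) :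
    Prop where
  eq_bot_of_lt : ∀ j : ℤ, j < e → 𝒲 j = ⊥
  ne_bot : (∃ j : ℤ, 𝒲 j ≠ ⊥) → 𝒲 e ≠ ⊥

/-- The graded maximal ideal `(x₁, …, xₙ)` of `S`. -/
noncomputable def irrelevantIdeal (K : Type u) [Field K] (n : ℕ) : Ideal (MvPolynomial (Fin n) K) :=
  Ideal.span (Set.range MvPolynomial.X)

/-- An isomorphism of graded `S`-modules (of degree `0`). -/
structure GradedIso {K : Type u} [Field K] {n : ℕ}
    {V : Type v} [AddCommGroup V] [Module (MvPolynomial (Fin n) K) V]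
    {W : Type w} [AddCommGroup W] [Module (MvPolynomial (Fin n) K) W]
    (𝒱 : ℤ → AddSubgroup V) (𝒲 : ℤ → AddSubgroup W) where
  toEquiv : V ≃ₗ[MvPolynomial (Fin n) K] W
  mem_iff : ∀ (j : ℤ) (x : V), toEquiv x ∈ 𝒲 j ↔ x ∈ 𝒱 j

/-- A complex `⋯ → X 2 → X 1 → X 0 → 0` of graded `S`-modules, with differentials of degree `0`. -/
structure GradedComplex (K : Type u) [Field K] (n : ℕ) where
  X : ℕ → Type v
  [addCommGroup : ∀ i, AddCommGroup (X i)]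
  [module : ∀ i, Module (MvPolynomial (Fin n) K) (X i)]
  gr : ∀ i, ℤ → AddSubgroup (X i)
  isGrading : ∀ i, IsGrading (K := K) (n := n) (gr i)
  d : ∀ i, X (i + 1) →ₗ[MvPolynomial (Fin n) K] X i
  d_mem : ∀ (i : ℕ) (j : ℤ) (x : X (i + 1)), x ∈ gr (i + 1) j → d i x ∈ gr i j
  d_comp : ∀ i, d i ∘ₗ d (i + 1) = 0

attribute [instance] GradedComplex.addCommGroup GradedComplex.module

namespace GradedComplex

variable {K : Type u} [Field K] {n : ℕ}

/-- The complex has `X i = S(-i-d)^{b_i}`: each `X i` is free with a finite basis consisting of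
homogeneous elements of degree `i + d`. -/
def IsLinear (G : GradedComplex.{u, v} K n) (d : ℤ) : Prop :=
  ∀ i : ℕ, ∃ (b : ℕ) (B : Module.Basis (Fin b) (MvPolynomial (Fin n) K) (G.X i)),
    ∀ k, B k ∈ G.gr i ((i : ℤ) + d)

/-- The complex is finite: its modules vanish in all large homological degrees. -/
def IsFinite (G : GradedComplex.{u, v} K n) : Prop :=
  ∃ N : ℕ, ∀ i, N ≤ i → Subsingleton (G.X i)

/-- The cycles in homological degree `i`; everything for `i = 0`. -/
noncomputable def cycles (G : GradedComplex.{u, v} K n) :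
    (i : ℕ) → Submodule (MvPolynomial (Fin n) K) (G.X i)
  | 0 => ⊤
  | i + 1 => LinearMap.ker (G.d i)

/-- The homology `H_i`, cycles modulo boundaries. -/
noncomputable abbrev homology (G : GradedComplex.{u, v} K n) (i : ℕ) : Type v :=
  G.cycles i ⧸ (LinearMap.range (G.d i)).comap (G.cycles i).subtype

/-- The graded component `H_i(G)_t`: the classes of the cycles of degree `t`. -/
noncomputable def homologyPiece (G : GradedComplex.{u, v} K n) (i : ℕ) (t : ℤ) : AddSubgroup (G.homology i) :=
  ((G.gr i t).comap (G.cycles i).subtype.toAddMonoidHom).map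
    ((LinearMap.range (G.d i)).comap (G.cycles i).subtype).mkQ.toAddMonoidHom

/-- An isomorphism of graded complexes. -/
structure Iso (C : GradedComplex.{u, v} K n) (D : GradedComplex.{u, w} K n) where
  iso : ∀ i, GradedIso (K := K) (n := n) (C.gr i) (D.gr i)
  comm : ∀ (i : ℕ) (x : C.X (i + 1)),
    (iso i).toEquiv (C.d i x) = D.d i ((iso (i + 1)).toEquiv x)

/-- An isomorphism of graded maps between `C₁ → C₀` and `D₁ → D₀`. -/
structure FirstMapIso (C : GradedComplex.{u, v} K n) (D : GradedComplex.{u, w} K n) where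
  iso₀ : GradedIso (K := K) (n := n) (C.gr 0) (D.gr 0)
  iso₁ : GradedIso (K := K) (n := n) (C.gr 1) (D.gr 1)
  comm : ∀ x : C.X 1, iso₀.toEquiv (C.d 0 x) = D.d 0 (iso₁.toEquiv x)

end GradedComplex

/-- A minimal graded free resolution of a graded module `W`: the `F_i` are free with finite
homogeneous bases, `⋯ → F_1 → F_0 → W → 0` is exact with all maps of degree `0`, and
`∂(F_{i+1}) ⊆ (x₁, …, xₙ) F_i`. -/
structure MinimalResolution {K : Type u} [Field K] {n : ℕ} {W : Type w} [AddCommGroup W]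
    [Module (MvPolynomial (Fin n) K) W] (𝒲 : ℤ → AddSubgroup W)
    extends GradedComplex.{u, v} K n where
  rank : ℕ → ℕ
  basis : ∀ i, Module.Basis (Fin (rank i)) (MvPolynomial (Fin n) K) (X i)
  deg : ∀ i, Fin (rank i) → ℤ
  basis_mem : ∀ (i : ℕ) (k : Fin (rank i)), basis i k ∈ gr i (deg i k)
  aug : X 0 →ₗ[MvPolynomial (Fin n) K] W
  aug_mem : ∀ (j : ℤ) (x : X 0), x ∈ gr 0 j → aug x ∈ 𝒲 j
  aug_surjective : Function.Surjective aug
  exact_zero : Function.Exact (d 0) aug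
  exact_succ : ∀ i, Function.Exact (d (i + 1)) (d i)
  minimal : ∀ i, LinearMap.range (d i) ≤
    irrelevantIdeal K n • (⊤ : Submodule (MvPolynomial (Fin n) K) (X i))

section Helpers

variable {K : Type u} [Field K] {n : ℕ} {W : Type v} [AddCommGroup W]
    [Module (MvPolynomial (Fin n) K) W]

/-- A submodule generated by homogeneous elements is graded by the induced grading. -/
theorem isGrading_span {𝒲 : ℤ → AddSubgroup W} (h : IsGrading (K := K) (n := n) 𝒲)
    (s : Set W) (hs : ∀ x ∈ s, ∃ j, x ∈ 𝒲 j) :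
    IsGrading (K := K) (n := n) (W := Submodule.span (MvPolynomial (Fin n) K) s)
      (fun j => (𝒲 j).comap
        (Submodule.span (MvPolynomial (Fin n) K) s).subtype.toAddMonoidHom) := by
  set N := Submodule.span (MvPolynomial (Fin n) K) s with hN
  set 𝒩 : ℤ → AddSubgroup N := fun j => (𝒲 j).comap N.subtype.toAddMonoidHom with h𝒩
  refine ⟨⟨?_, ?_⟩, ?_⟩
  · let m : (DirectSum ℤ fun j => 𝒩 j) →+ DirectSum ℤ fun j => 𝒲 j :=
      DirectSum.map fun j =>
        (N.subtype.toAddMonoidHom.comp (𝒩 j).subtype).codRestrict (𝒲 j) fun x => x.2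
    have hm : Function.Injective m := by
      refine (DirectSum.map_injective _).2 fun j x y hxy => ?_
      have := congrArg (Subtype.val) hxy
      exact Subtype.ext (Subtype.ext this)
    have hcomm : (DirectSum.coeAddMonoidHom 𝒲).comp m =
        N.subtype.toAddMonoidHom.comp (DirectSum.coeAddMonoidHom 𝒩) := by
      ext j x
      simp only [AddMonoidHom.comp_apply, m, DirectSum.map_of, DirectSum.coeAddMonoidHom_of]
      rfl
    intro x y hxy
    apply hm
    apply h.isInternal.injective
    have h1 := DFunLike.congr_fun hcomm x
    have h2 := DFunLike.congr_fun hcomm y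
    simp only [AddMonoidHom.comp_apply] at h1 h2
    rw [h1, h2, hxy]
  · have key : ∀ x (hx : x ∈ N), (⟨x, hx⟩ : N) ∈ (DirectSum.coeAddMonoidHom 𝒩).range := by
      intro x hx
      induction hx using Submodule.span_induction with
      | mem x hx =>
        obtain ⟨j, hj⟩ := hs x hx
        exact ⟨DirectSum.of (fun j => 𝒩 j) j ⟨⟨x, Submodule.subset_span hx⟩, hj⟩, by simp⟩
      | zero => exact zero_mem _
      | add x y hx hy h1 h2 => exact add_mem h1 h2
      | smul f x hx h1 =>
        obtain ⟨z, hz⟩ := h1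
        have : (⟨f • x, N.smul_mem f hx⟩ : N) = f • DirectSum.coeAddMonoidHom 𝒩 z := by
          rw [hz]; rfl
        rw [this]
        clear this hz
        induction z using DirectSum.induction_on with
        | zero => simp
        | add z₁ z₂ h1 h2 => rw [map_add, smul_add]; exact add_mem h1 h2
        | of j y =>
          rw [DirectSum.coeAddMonoidHom_of]
          rw [← MvPolynomial.sum_homogeneousComponent f, Finset.sum_smul]
          refine sum_mem fun a _ => ?_
          exact ⟨DirectSum.of (fun j => 𝒩 j) ((a : ℤ) + j)
            ⟨MvPolynomial.homogeneousComponent a f • (y : N),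
              h.smul_mem a j _ _ (MvPolynomial.homogeneousComponent_isHomogeneous a f) y.2⟩,
            by simp⟩
    rintro ⟨x, hx⟩
    exact key x hx
  · intro a j f x hf hx
    exact h.smul_mem a j f x hf hx

/-- The coordinates, in a homogeneous basis, of a homogeneous element are homogeneous. -/
theorem homogeneousComponent_repr {𝒲 : ℤ → AddSubgroup W}
    (h : IsGrading (K := K) (n := n) 𝒲) {r : ℕ}
    (B : Module.Basis (Fin r) (MvPolynomial (Fin n) K) W) (deg : Fin r → ℤ)
    (hB : ∀ k, B k ∈ 𝒲 (deg k)) {j : ℤ} {x : W} (hx : x ∈ 𝒲 j) (k : Fin r) (a : ℕ)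
    (ha : (a : ℤ) + deg k ≠ j) :
    MvPolynomial.homogeneousComponent a (B.repr x k) = 0 := by
  classical
  let c : Fin r → ℕ → W := fun k a => MvPolynomial.homogeneousComponent a (B.repr x k) • B k
  have hc : ∀ (k : Fin r) (a : ℕ), c k a ∈ 𝒲 ((a : ℤ) + deg k) := fun k a =>
    h.smul_mem a _ _ _ (MvPolynomial.homogeneousComponent_isHomogeneous a _) (hB k)
  let z : DirectSum ℤ fun j => 𝒲 j :=
    ∑ k, ∑ a ∈ Finset.range ((B.repr x k).totalDegree + 1),
      DirectSum.of (fun j => 𝒲 j) ((a : ℤ) + deg k) ⟨c k a, hc k a⟩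
  have hz : DirectSum.coeAddMonoidHom 𝒲 z = x := by
    simp only [z, map_sum, DirectSum.coeAddMonoidHom_of, c]
    simp only [← Finset.sum_smul, MvPolynomial.sum_homogeneousComponent]
    exact B.sum_repr x
  have hz' : z = DirectSum.of (fun j => 𝒲 j) j ⟨x, hx⟩ := by
    apply h.isInternal.injective
    rw [hz, DirectSum.coeAddMonoidHom_of]
  have h0 : ((z ((a : ℤ) + deg k) : 𝒲 ((a : ℤ) + deg k)) : W) = 0 := by
    rw [hz', DirectSum.of_eq_of_ne _ _ _ ha]
    rfl
  have h1 : ((z ((a : ℤ) + deg k) : 𝒲 ((a : ℤ) + deg k)) : W) =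
      ∑ l, ∑ b ∈ Finset.range ((B.repr x l).totalDegree + 1),
        if (b : ℤ) + deg l = (a : ℤ) + deg k then c l b else 0 := by
    simp only [z, AddSubgroup.val_finsetSum, DirectSum.sum_apply]
    refine Finset.sum_congr rfl fun l _ => Finset.sum_congr rfl fun b _ => ?_
    rw [DirectSum.coe_of_apply]
    split_ifs <;> rfl
  rw [h1] at h0
  have h2 := congrArg (fun y => B.repr y k) h0
  simp only [map_sum, Finsupp.coe_finsetSum, Finset.sum_apply, map_zero, Finsupp.coe_zero,
    Pi.zero_apply] at h2
  rw [Finset.sum_eq_single k] at h2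
  · by_cases hmem : a ∈ Finset.range ((B.repr x k).totalDegree + 1)
    · rw [Finset.sum_eq_single_of_mem a hmem] at h2
      · simpa [c] using h2
      · intro b _ hb
        rw [if_neg (by omega)]
        simp
    · exact MvPolynomial.homogeneousComponent_eq_zero _ _ (by simp at hmem; omega)
  · intro l _ hl
    refine Finset.sum_eq_zero fun b _ => ?_
    split_ifs
    · simp [c, hl]
    · simp
  · simp

/-- Coordinates of elements of `(x₁, …, xₙ) W` have no constant term. -/
theorem homogeneousComponent_zero_repr {r : ℕ}
    (B : Module.Basis (Fin r) (MvPolynomial (Fin n) K) W) {x : W}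
    (hx : x ∈ irrelevantIdeal K n • (⊤ : Submodule (MvPolynomial (Fin n) K) W)) (k : Fin r) :
    MvPolynomial.homogeneousComponent 0 (B.repr x k) = 0 := by
  have hle : irrelevantIdeal K n ≤ RingHom.ker (MvPolynomial.constantCoeff (σ := Fin n) (R := K)) :=
    Ideal.span_le.2 (by rintro _ ⟨i, rfl⟩; simp)
  have : MvPolynomial.constantCoeff (B.repr x k) = 0 := by
    induction hx using Submodule.smul_induction_on' with
    | smul f hf y hy =>
      have : MvPolynomial.constantCoeff f = 0 := hle hf
      simp [this]
    | add y hy z hz h1 h2 => simp [h1, h2]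
  rw [MvPolynomial.homogeneousComponent_zero]
  rw [MvPolynomial.constantCoeff_eq] at this
  rw [this, map_zero]

end Helpers

namespace MinimalResolution

variable {K : Type u} [Field K] {n : ℕ} {W : Type w} [AddCommGroup W]
    [Module (MvPolynomial (Fin n) K) W] {𝒲 : ℤ → AddSubgroup W}

theorem basis_notMem (F : MinimalResolution.{u, v, w} (K := K) (n := n) 𝒲) (i : ℕ)
    (k : Fin (F.rank i)) : F.basis i k ∉ LinearMap.range (F.d i) := by
  intro h
  have := homogeneousComponent_zero_repr (F.basis i) (F.minimal i h) k
  simp [MvPolynomial.homogeneousComponent_zero] at this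

/-- The generators of `F_i` have degree at least `i + e`, where `e` is the initial degree. -/
theorem le_deg (F : MinimalResolution.{u, v, w} (K := K) (n := n) 𝒲) {e : ℤ}
    (he : IsInitialDegree 𝒲 e) (i : ℕ) (k : Fin (F.rank i)) : (i : ℤ) + e ≤ F.deg i k := by
  induction i with
  | zero =>
    by_contra hlt
    apply F.basis_notMem 0 k
    have h1 := F.aug_mem _ _ (F.basis_mem 0 k)
    rw [he.eq_bot_of_lt _ (by push_cast at hlt; omega)] at h1
    exact (F.exact_zero _).1 h1
  | succ i ih =>
    by_contra hlt
    apply F.basis_notMem (i + 1) k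
    refine (F.exact_succ i _).1 ?_
    have h1 := F.d_mem i _ _ (F.basis_mem (i + 1) k)
    apply (F.basis i).repr.injective
    ext1 l
    rw [map_zero, Finsupp.coe_zero, Pi.zero_apply,
      ← MvPolynomial.sum_homogeneousComponent (((F.basis i).repr _) l)]
    refine Finset.sum_eq_zero fun a _ => ?_
    rcases Nat.eq_zero_or_pos a with rfl | ha
    · exact homogeneousComponent_zero_repr _ (F.minimal i ⟨_, rfl⟩) l
    · refine homogeneousComponent_repr (F.isGrading i) _ _ (F.basis_mem i) h1 l a ?_
      have := ih l
      push_cast at hlt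
      omega

/-- `F_i^lin`: the direct summand `S(-i-e)^{β_{i,i+e}}` of `F_i`, spanned by the basis elements of
degree `i + e`. -/
noncomputable def lin (F : MinimalResolution.{u, v, w} (K := K) (n := n) 𝒲) (e : ℤ) (i : ℕ) :
    Submodule (MvPolynomial (Fin n) K) (F.X i) :=
  Submodule.span _ {x | ∃ k, F.deg i k = (i : ℤ) + e ∧ F.basis i k = x}

/-- The differential maps `F_{i+1}^lin` to `F_i^lin`. -/
theorem d_mem_lin (F : MinimalResolution.{u, v, w} (K := K) (n := n) 𝒲) {e : ℤ}
    (he : IsInitialDegree 𝒲 e) (i : ℕ) :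
    ∀ x ∈ F.lin e (i + 1), F.d i x ∈ F.lin e i := by
  suffices F.lin e (i + 1) ≤ (F.lin e i).comap (F.d i) from fun x hx => this hx
  refine Submodule.span_le.2 ?_
  rintro _ ⟨k, hk, rfl⟩
  change F.d i (F.basis (i + 1) k) ∈ F.lin e i
  have h1 := F.d_mem i _ _ (F.basis_mem (i + 1) k)
  rw [← (F.basis i).sum_repr (F.d i (F.basis (i + 1) k))]
  refine Submodule.sum_mem _ fun l _ => ?_
  by_cases hl : F.deg i l = (i : ℤ) + e
  · exact Submodule.smul_mem _ _ (Submodule.subset_span ⟨l, hl, rfl⟩)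
  · have : (F.basis i).repr (F.d i (F.basis (i + 1) k)) l = 0 := by
      rw [← MvPolynomial.sum_homogeneousComponent (((F.basis i).repr _) l)]
      refine Finset.sum_eq_zero fun a _ => ?_
      rcases Nat.eq_zero_or_pos a with rfl | ha
      · exact homogeneousComponent_zero_repr _ (F.minimal i ⟨_, rfl⟩) l
      · refine homogeneousComponent_repr (F.isGrading i) _ _ (F.basis_mem i) h1 l a ?_
        have := F.le_deg he i l
        push_cast at hk
        omega
    rw [this, zero_smul]
    exact zero_mem _

/-- The linear strand `⋯ → F_1^lin → F_0^lin → 0` of the module `W` with initial degree `e`, a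
subcomplex of its minimal graded free resolution `F`. -/
noncomputable def linearStrand (F : MinimalResolution.{u, v, w} (K := K) (n := n) 𝒲) {e : ℤ}
    (he : IsInitialDegree 𝒲 e) : GradedComplex.{u, v} K n where
  X i := F.lin e i
  gr i j := (F.gr i j).comap (F.lin e i).subtype.toAddMonoidHom
  isGrading i := isGrading_span (F.isGrading i) _ (by
    rintro _ ⟨k, _, rfl⟩
    exact ⟨_, F.basis_mem i k⟩)
  d i := (F.d i).restrict (F.d_mem_lin he i)
  d_mem i j x hx := F.d_mem i j x hx
  d_comp i := by
    ext x
    exact LinearMap.congr_fun (F.d_comp i) (x : F.X (i + 1 + 1))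

end MinimalResolution

end LinStrand

/-! A linear complex `G` with the stated homology vanishing is determined by `G_1 → G_0`. For i > 0,
boundaries in `G_i` live in degrees ≥ i + 1 + d, so H_i = 0 in degree i + d means that the
differential is injective on the degree in which `G_i` is generated. H_i = 0 in degree i + 1 + d
means that every cycle of that degree is the image of a combination, over K, of generators of
`G_{i+1}`. Together these identify the span over K of the generators of `G_{i+1}` with the cycles of
degree i + 1 + d in `G_i`.

`IsStrand` records these two properties, and `linearStrand_isStrand` derives them for the linear
strand from exactness of the resolution and the bound `le_deg`. For two strands with the same `d`,
`exists_lift` and `eq_id` give existence and uniqueness of lifts, hence an isomorphism by recursion.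
The initial degrees agree unless `G_0 = 0`, and then both complexes vanish. -/

namespace LinStrand

/-! ### Graded linear maps and homogeneous bases. -/

section Graded

variable {K : Type*} [Field K] {n : ℕ}
  {V : Type*} [AddCommGroup V] [Module (MvPolynomial (Fin n) K) V]
  {W : Type*} [AddCommGroup W] [Module (MvPolynomial (Fin n) K) W]
  {𝒱 : ℤ → AddSubgroup V} {𝒲 : ℤ → AddSubgroup W}

/-- A homogeneous element in the range of a graded map has a preimage of the same degree. -/
theorem exists_homogeneous_preimage (hV : IsGrading (K := K) (n := n) 𝒱)
    (hW : IsGrading (K := K) (n := n) 𝒲) (f : V →ₗ[MvPolynomial (Fin n) K] W)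
    (hf : ∀ j x, x ∈ 𝒱 j → f x ∈ 𝒲 j) {t : ℤ} {x : W} (hx : x ∈ 𝒲 t)
    (hr : x ∈ LinearMap.range f) : ∃ y ∈ 𝒱 t, f y = x := by
  obtain ⟨y, rfl⟩ := hr
  obtain ⟨z, rfl⟩ := hV.isInternal.surjective y
  -- Since `f` acts degree by degree, the component of degree `t` of any preimage is again a
  -- preimage.
  let g : ∀ j, 𝒱 j →+ 𝒲 j := fun j =>
    (f.toAddMonoidHom.comp (𝒱 j).subtype).codRestrict (𝒲 j) fun x => hf j _ x.2
  have hcomm : (DirectSum.coeAddMonoidHom 𝒲).comp (DirectSum.map g) =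
      f.toAddMonoidHom.comp (DirectSum.coeAddMonoidHom 𝒱) := by
    ext j x
    simp only [AddMonoidHom.comp_apply, DirectSum.map_of, DirectSum.coeAddMonoidHom_of]
    rfl
  have h1 : DirectSum.map g z = DirectSum.of (fun j => 𝒲 j) t ⟨_, hx⟩ := by
    apply hW.isInternal.injective
    rw [DirectSum.coeAddMonoidHom_of]
    exact DFunLike.congr_fun hcomm z
  refine ⟨z t, (z t).2, ?_⟩
  have h2 := congrArg (fun w => ((w t : 𝒲 t) : W)) h1
  simp only [DirectSum.map_apply, DirectSum.of_eq_same] at h2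
  exact h2

/-- The coordinates of an element of degree `j` vanish at the basis elements of degree greater
than `j`. -/
theorem repr_eq_zero_of_lt (hV : IsGrading (K := K) (n := n) 𝒱) {r : ℕ}
    (B : Module.Basis (Fin r) (MvPolynomial (Fin n) K) V) (deg : Fin r → ℤ)
    (hB : ∀ k, B k ∈ 𝒱 (deg k)) {j : ℤ} {x : V} (hx : x ∈ 𝒱 j) (k : Fin r) (hk : j < deg k) :
    B.repr x k = 0 := by
  rw [← MvPolynomial.sum_homogeneousComponent (B.repr x k)]
  exact Finset.sum_eq_zero fun a _ => homogeneousComponent_repr hV B deg hB hx k a (by omega)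

theorem eq_zero_of_degree_lt (hV : IsGrading (K := K) (n := n) 𝒱) {r : ℕ}
    (B : Module.Basis (Fin r) (MvPolynomial (Fin n) K) V) (deg : Fin r → ℤ)
    (hB : ∀ k, B k ∈ 𝒱 (deg k)) {j : ℤ} {x : V} (hx : x ∈ 𝒱 j) (hj : ∀ k, j < deg k) :
    x = 0 :=
  B.repr.map_eq_zero_iff.1 <| Finsupp.ext fun k => repr_eq_zero_of_lt hV B deg hB hx k (hj k)

/-- A linear map is graded if it preserves the degrees of the elements of a homogeneous basis. -/
theorem map_mem_of_basis (hV : IsGrading (K := K) (n := n) 𝒱)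
    (hW : IsGrading (K := K) (n := n) 𝒲) {r : ℕ}
    (B : Module.Basis (Fin r) (MvPolynomial (Fin n) K) V) (deg : Fin r → ℤ)
    (hB : ∀ k, B k ∈ 𝒱 (deg k)) (f : V →ₗ[MvPolynomial (Fin n) K] W)
    (hf : ∀ k, f (B k) ∈ 𝒲 (deg k)) {j : ℤ} {x : V} (hx : x ∈ 𝒱 j) : f x ∈ 𝒲 j := by
  rw [← B.sum_repr x, map_sum]
  refine sum_mem fun k _ => ?_
  rw [map_smul, ← MvPolynomial.sum_homogeneousComponent (B.repr x k), Finset.sum_smul]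
  refine sum_mem fun a _ => ?_
  by_cases ha : (a : ℤ) + deg k = j
  · rw [← ha]
    exact hW.smul_mem a _ _ _ (MvPolynomial.homogeneousComponent_isHomogeneous a _) (hf k)
  · rw [homogeneousComponent_repr hV B deg hB hx k a ha, zero_smul]
    exact zero_mem _

/-- The inverse of a graded isomorphism. -/
noncomputable def GradedIso.symm (φ : GradedIso (K := K) (n := n) 𝒱 𝒲) :
    GradedIso (K := K) (n := n) 𝒲 𝒱 where
  toEquiv := φ.toEquiv.symm
  mem_iff j x := by
    rw [← φ.mem_iff, LinearEquiv.apply_symm_apply]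

/-- The isomorphism between two zero modules. -/
noncomputable def GradedIso.ofSubsingleton [Subsingleton V] [Subsingleton W] :
    GradedIso (K := K) (n := n) 𝒱 𝒲 where
  toEquiv :=
    { toFun := 0
      invFun := 0
      map_add' := fun _ _ => Subsingleton.elim _ _
      map_smul' := fun _ _ => Subsingleton.elim _ _
      left_inv := fun _ => Subsingleton.elim _ _
      right_inv := fun _ => Subsingleton.elim _ _ }
  mem_iff j x := by
    rw [Subsingleton.elim x 0, map_zero]
    exact iff_of_true (zero_mem _) (zero_mem _)

end Graded

/-! ### Strands and their rigidity. -/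

namespace GradedComplex

variable {K : Type*} [Field K] {n : ℕ}

/-- A linear complex with initial degree `d` such that, in each positive homological degree `i`,
its homology vanishes in the internal degrees `i + d` and `i + d + 1`, in terms of elements. -/
structure IsStrand (G : GradedComplex K n) (d : ℤ) : Prop where
  isLinear : G.IsLinear d
  eq_zero : ∀ (i : ℕ) (x : G.X (i + 1)), x ∈ G.gr (i + 1) (((i + 1 : ℕ) : ℤ) + d) →
    G.d i x = 0 → x = 0
  exists_preimage : ∀ (i : ℕ) (x : G.X (i + 1)), x ∈ G.gr (i + 1) (((i + 1 + 1 : ℕ) : ℤ) + d) →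
    G.d i x = 0 → ∃ y ∈ G.gr (i + 1 + 1) (((i + 1 + 1 : ℕ) : ℤ) + d), G.d (i + 1) y = x

theorem exists_preimage_of_homologyPiece_eq_bot (G : GradedComplex K n) (i : ℕ) (t : ℤ)
    (h : G.homologyPiece (i + 1) t = ⊥) (x : G.X (i + 1)) (hx : x ∈ G.gr (i + 1) t)
    (hd : G.d i x = 0) : ∃ y ∈ G.gr (i + 1 + 1) t, G.d (i + 1) y = x := by
  refine exists_homogeneous_preimage (G.isGrading _) (G.isGrading _) _ (G.d_mem (i + 1)) hx ?_
  let z : G.cycles (i + 1) := ⟨x, hd⟩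
  have h1 : ((LinearMap.range (G.d (i + 1))).comap (G.cycles (i + 1)).subtype).mkQ z ∈
      G.homologyPiece (i + 1) t := ⟨z, hx, rfl⟩
  rw [h, AddSubgroup.mem_bot, Submodule.mkQ_apply, Submodule.Quotient.mk_eq_zero] at h1
  exact h1

theorem isStrand_of_homologyPiece_eq_bot (G : GradedComplex K n) (d : ℤ) (hlin : G.IsLinear d)
    (hb : ∀ i : ℕ, 0 < i → ∀ j : ℤ, j = 0 ∨ j = 1 →
      G.homologyPiece i ((i : ℤ) + d + j) = ⊥) : G.IsStrand d where
  isLinear := hlin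
  eq_zero i x hx hd := by
    obtain ⟨y, hy, rfl⟩ := G.exists_preimage_of_homologyPiece_eq_bot i _
      (hb (i + 1) i.succ_pos 0 (Or.inl rfl)) x (by rwa [add_zero]) hd
    obtain ⟨r, B, hB⟩ := hlin (i + 1 + 1)
    -- The preimage `y` has degree i + 1 + d, one below the generators of `G_{i+2}`.
    rw [eq_zero_of_degree_lt (G.isGrading _) B _ hB hy (fun _ => by push_cast; omega), map_zero]
  exists_preimage i x hx hd := by
    have ht : (((i + 1 + 1 : ℕ) : ℤ) + d) = ((i + 1 : ℕ) : ℤ) + d + 1 := by push_cast; ring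
    rw [ht] at hx ⊢
    exact G.exists_preimage_of_homologyPiece_eq_bot i _
      (hb (i + 1) i.succ_pos 1 (Or.inr rfl)) x hx hd

namespace IsStrand

variable {G : GradedComplex K n} {H : GradedComplex K n} {d : ℤ}

/-- A strand starting with zero is zero. -/
theorem subsingleton (hG : G.IsStrand d) (h0 : Subsingleton (G.X 0)) (i : ℕ) :
    Subsingleton (G.X i) := by
  induction i with
  | zero => exact h0
  | succ i ih =>
    obtain ⟨r, B, hB⟩ := hG.isLinear (i + 1)
    refine subsingleton_of_forall_eq 0 fun x => ?_
    rw [← B.sum_repr x]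
    refine Finset.sum_eq_zero fun k _ => ?_
    -- A generator is a cycle because the target is zero, and the differential is injective in its
    -- degree.
    rw [hG.eq_zero i _ (hB k) (Subsingleton.elim _ _), smul_zero]

/-- A graded map in homological degree `i + 1` compatible with the differentials lifts to
homological degree `i + 2`. -/
theorem exists_lift (hG : G.IsStrand d) (hH : H.IsStrand d) (i : ℕ)
    (f₀ : GradedIso (K := K) (n := n) (G.gr i) (H.gr i))
    (f₁ : GradedIso (K := K) (n := n) (G.gr (i + 1)) (H.gr (i + 1)))
    (hf : ∀ x, f₀.toEquiv (G.d i x) = H.d i (f₁.toEquiv x)) :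
    ∃ g : G.X (i + 1 + 1) →ₗ[MvPolynomial (Fin n) K] H.X (i + 1 + 1),
      (∀ j x, x ∈ G.gr (i + 1 + 1) j → g x ∈ H.gr (i + 1 + 1) j) ∧
      ∀ x, f₁.toEquiv (G.d (i + 1) x) = H.d (i + 1) (g x) := by
  obtain ⟨r, B, hB⟩ := hG.isLinear (i + 1 + 1)
  -- The image of a generator is a cycle in degree i + 2 + d, exactly where cycles of `H` are
  -- boundaries.
  have h (k : Fin r) := hH.exists_preimage i (f₁.toEquiv (G.d (i + 1) (B k)))
    ((f₁.mem_iff _ _).2 (G.d_mem _ _ _ (hB k))) (by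
      rw [← hf, ← LinearMap.comp_apply, G.d_comp, LinearMap.zero_apply, map_zero])
  choose y hy hdy using h
  refine ⟨B.constr ℕ y, fun j x hx => ?_, fun x => ?_⟩
  · refine map_mem_of_basis (G.isGrading _) (H.isGrading _) B _ hB _ (fun k => ?_) hx
    rw [B.constr_basis]
    exact hy k
  · have : f₁.toEquiv.toLinearMap ∘ₗ G.d (i + 1) = H.d (i + 1) ∘ₗ B.constr ℕ y :=
      B.ext fun k => by simp [hdy]
    exact LinearMap.congr_fun this x

/-- A degree-preserving endomorphism compatible with the differentials and the identity in lower
homological degree is the identity. -/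
theorem eq_id (hG : G.IsStrand d) (i : ℕ)
    (g : G.X (i + 1) →ₗ[MvPolynomial (Fin n) K] G.X (i + 1))
    (hg : ∀ j x, x ∈ G.gr (i + 1) j → g x ∈ G.gr (i + 1) j)
    (hd : ∀ x, G.d i (g x) = G.d i x) : g = LinearMap.id := by
  obtain ⟨r, B, hB⟩ := hG.isLinear (i + 1)
  -- The difference `g (B k) - B k` is a cycle in the generating degree, hence zero.
  refine B.ext fun k => sub_eq_zero.1 (hG.eq_zero i _ (sub_mem (hg _ _ (hB k)) (hB k)) ?_)
  rw [map_sub, hd, LinearMap.id_apply, sub_self]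

/-- An isomorphism between strands extends from homological degrees `i`, `i + 1` to `i + 2`. -/
theorem exists_gradedIso (hG : G.IsStrand d) (hH : H.IsStrand d) (i : ℕ)
    (f₀ : GradedIso (K := K) (n := n) (G.gr i) (H.gr i))
    (f₁ : GradedIso (K := K) (n := n) (G.gr (i + 1)) (H.gr (i + 1)))
    (hf : ∀ x, f₀.toEquiv (G.d i x) = H.d i (f₁.toEquiv x)) :
    ∃ f₂ : GradedIso (K := K) (n := n) (G.gr (i + 1 + 1)) (H.gr (i + 1 + 1)),
      ∀ x, f₁.toEquiv (G.d (i + 1) x) = H.d (i + 1) (f₂.toEquiv x) := by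
  obtain ⟨g, hg, hgd⟩ := hG.exists_lift hH i f₀ f₁ hf
  obtain ⟨g', hg', hgd'⟩ := hH.exists_lift hG i f₀.symm f₁.symm fun x => by
    apply f₀.toEquiv.injective
    rw [hf]
    simp [GradedIso.symm]
  -- Both composites lift the identity, so uniqueness of lifts makes `g` and `g'` mutually inverse.
  have h1 : g' ∘ₗ g = LinearMap.id := hG.eq_id _ _ (fun j x hx => hg' j _ (hg j x hx))
    fun x => by
      rw [LinearMap.comp_apply, ← hgd', ← hgd]
      simp [GradedIso.symm]
  have h2 : g ∘ₗ g' = LinearMap.id := hH.eq_id _ _ (fun j x hx => hg j _ (hg' j x hx))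
    fun x => by
      rw [LinearMap.comp_apply, ← hgd, ← hgd']
      simp [GradedIso.symm]
  refine ⟨⟨LinearEquiv.ofLinearMap g g' h2 h1, fun j x => ⟨fun hx => ?_, hg j x⟩⟩, hgd⟩
  have := hg' j _ hx
  rwa [LinearEquiv.coe_ofLinearMap, ← LinearMap.comp_apply, h1] at this

/-- Two strands of the same initial degree are isomorphic as soon as their first maps are. -/
theorem nonempty_iso (hG : G.IsStrand d) (hH : H.IsStrand d) (h : G.FirstMapIso H) :
    Nonempty (G.Iso H) := by
  -- Each extension needs two consecutive isomorphisms, so the recursion carries the pair. The first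
  -- entry at i + 1 is by definition the second entry at i, which makes the squares fit together.
  let T : ℕ → Type _ := fun i =>
    {p : GradedIso (K := K) (n := n) (G.gr i) (H.gr i) ×
        GradedIso (K := K) (n := n) (G.gr (i + 1)) (H.gr (i + 1)) //
      ∀ x, p.1.toEquiv (G.d i x) = H.d i (p.2.toEquiv x)}
  let Φ : ∀ i, T i := fun i => Nat.rec ⟨(h.iso₀, h.iso₁), h.comm⟩
    (fun i p => ⟨(p.1.2, (hG.exists_gradedIso hH i p.1.1 p.1.2 p.2).choose),
      (hG.exists_gradedIso hH i p.1.1 p.1.2 p.2).choose_spec⟩) i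
  exact ⟨⟨fun i => (Φ i).1.1, fun i x => (Φ i).2 x⟩⟩

/-- A generator of `G_0` has degree `d` and a nonzero image in `H_0`, which has no nonzero elements
in degrees below `e`. -/
theorem le_of_nontrivial {e : ℤ} (hG : G.IsStrand d) (hH : H.IsStrand e)
    (φ : GradedIso (K := K) (n := n) (G.gr 0) (H.gr 0)) (h0 : Nontrivial (G.X 0)) : e ≤ d := by
  obtain ⟨r, B, hB⟩ := hG.isLinear 0
  obtain ⟨s, C, hC⟩ := hH.isLinear 0
  obtain ⟨k⟩ := B.index_nonempty
  by_contra hlt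
  refine B.ne_zero k (φ.toEquiv.map_eq_zero_iff.1 ?_)
  exact eq_zero_of_degree_lt (H.isGrading 0) C _ hC ((φ.mem_iff _ _).2 (hB k))
    (fun _ => by omega)

end IsStrand

end GradedComplex

/-! ### The linear strand of a minimal resolution is a strand. -/

namespace MinimalResolution

variable {K : Type*} [Field K] {n : ℕ} {W : Type*} [AddCommGroup W]
    [Module (MvPolynomial (Fin n) K) W] {𝒲 : ℤ → AddSubgroup W}

theorem linearStrand_isLinear (F : MinimalResolution (K := K) (n := n) 𝒲) {e : ℤ}
    (he : IsInitialDegree 𝒲 e) : (F.linearStrand he).IsLinear e := by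
  intro i
  let ι := {k : Fin (F.rank i) // F.deg i k = (i : ℤ) + e}
  have hli : LinearIndependent (MvPolynomial (Fin n) K) fun k : ι => F.basis i k :=
    (F.basis i).linearIndependent.comp _ Subtype.val_injective
  have hrange : Set.range (fun k : ι => F.basis i k) =
      {x | ∃ k, F.deg i k = (i : ℤ) + e ∧ F.basis i k = x} := by
    ext x
    simp [ι]
  let E : Submodule.span (MvPolynomial (Fin n) K) (Set.range fun k : ι => F.basis i k)
      ≃ₗ[MvPolynomial (Fin n) K] F.lin e i :=
    LinearEquiv.ofEq _ _ (by rw [hrange, lin])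
  refine ⟨Fintype.card ι, ((Module.Basis.span hli).map E).reindex (Fintype.equivFin ι),
    fun k => ?_⟩
  have h1 : ((((Module.Basis.span hli).map E).reindex (Fintype.equivFin ι)) k : F.X i) =
      F.basis i ((Fintype.equivFin ι).symm k) := by
    rw [Module.Basis.reindex_apply, Module.Basis.map_apply, LinearEquiv.coe_ofEq_apply,
      Module.Basis.span_apply]
  change ((((Module.Basis.span hli).map E).reindex (Fintype.equivFin ι)) k : F.X i) ∈ F.gr i _
  rw [h1]
  obtain ⟨l, hl⟩ := (Fintype.equivFin ι).symm k
  have h2 := F.basis_mem i l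
  rwa [hl] at h2

/-- All generators of `F_i` have degree at least i + e, and those of larger degree cannot occur in
an element of degree i + e. Hence preimages found in `F` in this degree already lie in the linear
strand. -/
theorem mem_lin_of_mem_gr (F : MinimalResolution (K := K) (n := n) 𝒲) {e : ℤ}
    (he : IsInitialDegree 𝒲 e) (i : ℕ) {x : F.X i} (hx : x ∈ F.gr i ((i : ℤ) + e)) :
    x ∈ F.lin e i := by
  rw [← (F.basis i).sum_repr x]
  refine Submodule.sum_mem _ fun l _ => ?_
  by_cases hl : F.deg i l = (i : ℤ) + e
  · exact Submodule.smul_mem _ _ (Submodule.subset_span ⟨l, hl, rfl⟩)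
  · rw [repr_eq_zero_of_lt (F.isGrading i) _ _ (F.basis_mem i) hx l
      (lt_of_le_of_ne (F.le_deg he i l) (Ne.symm hl)), zero_smul]
    exact zero_mem _

/-- A cycle of the strand is a cycle of the exact complex `F`, so it has a homogeneous preimage
there. For a cycle of degree i + 1 + e this preimage lies below all generators of `F_{i+2}` and is
zero; one degree higher it lies in the strand. -/
theorem linearStrand_isStrand (F : MinimalResolution (K := K) (n := n) 𝒲) {e : ℤ}
    (he : IsInitialDegree 𝒲 e) : (F.linearStrand he).IsStrand e where
  isLinear := F.linearStrand_isLinear he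
  eq_zero i x hx hd := by
    have h0 : F.d i x.1 = 0 := congrArg Subtype.val hd
    obtain ⟨y, hy, hyx⟩ := exists_homogeneous_preimage (F.isGrading _) (F.isGrading _) _
      (F.d_mem (i + 1)) hx ((F.exact_succ i _).1 h0)
    refine Subtype.ext (hyx.symm.trans ?_)
    rw [eq_zero_of_degree_lt (F.isGrading _) (F.basis _) _ (F.basis_mem _) hy (fun k => ?_),
      map_zero]
    · rfl
    · have := F.le_deg he (i + 1 + 1) k
      push_cast at this ⊢
      omega
  exists_preimage i x hx hd := by
    have h0 : F.d i x.1 = 0 := congrArg Subtype.val hd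
    obtain ⟨y, hy, hyx⟩ := exists_homogeneous_preimage (F.isGrading _) (F.isGrading _) _
      (F.d_mem (i + 1)) hx ((F.exact_succ i _).1 h0)
    exact ⟨⟨y, F.mem_lin_of_mem_gr he _ hy⟩, hy, Subtype.ext hyx⟩

end MinimalResolution

end LinStrand

theorem corollary1p2 {K : Type*} [Field K] {n : ℕ}
    (G : LinStrand.GradedComplex K n) (d : ℤ)
    (hfin : G.IsFinite) (hlin : G.IsLinear d)
    (hb : ∀ i : ℕ, 0 < i → ∀ j : ℤ, j = 0 ∨ j = 1 → G.homologyPiece i ((i : ℤ) + d + j) = ⊥)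
    {W : Type*} [AddCommGroup W] [Module (MvPolynomial (Fin n) K) W]
    [Module.Finite (MvPolynomial (Fin n) K) W]
    (𝒲 : ℤ → AddSubgroup W) (h𝒲 : LinStrand.IsGrading (K := K) (n := n) 𝒲)
    (e : ℤ) (he : LinStrand.IsInitialDegree 𝒲 e)
    (F : LinStrand.MinimalResolution (K := K) (n := n) 𝒲)
    (h01 : Nonempty (G.FirstMapIso (F.linearStrand he))) :
    Nonempty (G.Iso (F.linearStrand he)) := by
  obtain ⟨φ⟩ := h01
  have hG := G.isStrand_of_homologyPiece_eq_bot d hlin hb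
  have hH := F.linearStrand_isStrand he
  -- If `G_0 = 0`, nothing relates `d` to `e`, but both complexes vanish. Otherwise comparing `G_0`
  -- with `F_0^lin` in both directions gives `d = e`.
  rcases subsingleton_or_nontrivial (G.X 0) with h0 | h0
  · have hGs := hG.subsingleton h0
    have hHs := hH.subsingleton φ.iso₀.toEquiv.symm.injective.subsingleton
    exact ⟨⟨fun _ => LinStrand.GradedIso.ofSubsingleton, fun _ _ => Subsingleton.elim _ _⟩⟩
  · obtain rfl : d = e := le_antisymm
      (hH.le_of_nontrivial hG φ.iso₀.symm φ.iso₀.toEquiv.injective.nontrivial)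
      (hG.le_of_nontrivial hH φ.iso₀ h0)
    exact hG.nonempty_iso hH φ
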